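/- Let $0<\alpha<1$, let $\theta\in\mathbb{R}$ with $|\theta|<\pi$, let $\rho>0$, $\nu\in\mathbb{C}$, and let $z\in\mathbb{C}\setminus[0,\infty)$. Let $\sqrt{-z}$ denote the square root of $-z$ with $\operatorname{Re}\sqrt{-z}>0$, and let $K_\mu(a)=\frac12\int_{-\infty}^{\infty}e^{\mu s-a\cosh s}\,ds$ ($\mu\in\mathbb{C}$, $\operatorname{Re}a>0$) be the Macdonald function (the modified Bessel function of the second kind). Then for every $r>0$ the integral below converges absolutely, and, with all parameters except $r$ fixed and with powers taken on their principal branch, $$\int_{-\infty}^{\infty}K_{i\tau}\big(\sqrt{-z}\,r\big)\,K_{i(\nu-\tau)}\big(\sqrt{-z}\,\rho\big)\,\frac{\sin(\pi\alpha)\,e^{\theta\tau}}{\pi\sin(\pi(\alpha+i\tau))}\,d\tau$$ $$=K_{i\nu}\big(\sqrt{-z}\,\rho\big)-\frac{\sin(\pi\alpha)}{\pi}\,\frac{\Gamma(\alpha)}{1-\alpha}\left(\frac{\sqrt{-z}\,r}{2}\right)^{1-\alpha}e^{i(\alpha-1)\theta}\,K_{i\nu-1+\alpha}\big(\sqrt{-z}\,\rho\big)$$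 $$\qquad-\frac{\sin(\pi\alpha)}{\pi}\,\frac{\Gamma(1-\alpha)}{\alpha}\left(\frac{\sqrt{-z}\,r}{2}\right)^{\alpha}e^{i\alpha\theta}\,K_{i\nu+\alpha}\big(\sqrt{-z}\,\rho\big)+O(r)\qquad\text{as } r\downarrow0 .$$ -/

import Mathlib

open Complex MeasureTheory Filter Topology Asymptotics

/-- The Macdonald function (modified Bessel function of the second kind) `K_μ(a)` of complex
order `μ` and argument `a` with `0 < Re a`, by its classical integral
`K_μ(a) = ½ ∫ exp (μ s - a cosh s) ds` over the real line, which converges absolutely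
for these values and equals `∫ exp (-a cosh s) cosh (μ s) ds` over `s > 0`. -/
noncomputable def besselK (μ a : ℂ) : ℂ :=
  (1 / 2 : ℂ) * ∫ s : ℝ, exp (μ * (s : ℂ) - a * cosh (s : ℂ))

/-! The multiplier `e^{θτ} π / sin(π(α+iτ))` is the Fourier transform of the logistic kernel `k(x) =
e^{α(x+iθ)}/(1+e^{x+iθ})`. Writing both Macdonald functions as integrals and integrating out `τ` by
Fourier inversion turns the integral over the order into `π/2 ∫ e^{iνt - b cosh t} (k * e^{-a
cosh})(t) dt` (`integral_besselK_mul_besselK`).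

With `a = 2c`, `e^{-a cosh s} = (1+p)(1+q)`, where `p = e^{-c e^s} - 1` and `q = e^{-c e^{-s}} - 1`.
Smoothing `1` by `k` gives the constant `π / sin(πα)`. Smoothing `p` and `q` gives the powers `c^α
e^{αt}` and `c^{1-α} e^{-(1-α)t}`, read off from the two exponential tails of `k`, with errors
`O(|c| e^{±t})`; the product `pq` costs only `O(|c|²)`. Integrated against `e^{iνt - b cosh t}`, a
factor `e^{κt}` shifts the order of the Macdonald function by `κ`, which yields the stated terms,
with error `O(r)` since `c` is proportional to `r`. -/

/-! ### Euler's Gamma integral in exponential coordinates. -/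

theorem integrable_rexp_mul_sub_mul_exp {σ κ : ℝ} (hσ : 0 < σ) (hκ : 0 < κ) :
    Integrable (fun u : ℝ => Real.exp (σ * u - κ * Real.exp u)) := by
  have key : Integrable (fun u : ℝ => Real.exp (σ * u - Real.exp u)) := by
    have h := integrableOn_image_iff_integrableOn_abs_deriv_smul (s := Set.univ) (f := Real.exp)
      (f' := Real.exp) MeasurableSet.univ (fun x _ => (Real.hasDerivAt_exp x).hasDerivWithinAt)
      Real.exp_injective.injOn (fun x : ℝ => Real.exp (-x) * x ^ (σ - 1))
    rw [Set.image_univ, Real.range_exp, integrableOn_univ] at h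
    refine (h.1 (Real.GammaIntegral_convergent hσ)).congr (Eventually.of_forall fun u => ?_)
    simp only [abs_of_pos (Real.exp_pos u), smul_eq_mul, ← Real.exp_mul, ← Real.exp_add]
    congr 1; ring
  have h2 := (key.comp_add_right (Real.log κ)).const_mul (Real.exp (-(σ * Real.log κ)))
  refine h2.congr (Eventually.of_forall fun u => ?_)
  beta_reduce
  rw [Real.exp_add u, Real.exp_log hκ, ← Real.exp_add]
  congr 1; ring

theorem integral_cexp_mul_sub_exp {s : ℂ} (hs : 0 < s.re) :
    ∫ u : ℝ, exp (s * u - exp u) = Gamma s := by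
  have h := integral_image_eq_integral_abs_deriv_smul (s := Set.univ) (f := Real.exp)
      (f' := Real.exp) MeasurableSet.univ (fun x _ => (Real.hasDerivAt_exp x).hasDerivWithinAt)
      Real.exp_injective.injOn (fun x : ℝ => (Real.exp (-x) : ℂ) * (x : ℂ) ^ (s - 1))
  rw [Set.image_univ, Real.range_exp, setIntegral_univ] at h
  rw [Gamma_eq_integral hs, GammaIntegral, h]
  refine integral_congr_ae (Eventually.of_forall fun u => ?_)
  have hne : (exp (u : ℂ)) ≠ 0 := exp_ne_zero _
  have him : (exp (u : ℂ)) ^ (s - 1) = exp (u * (s - 1)) := by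
    rw [cpow_def_of_ne_zero hne, ← ofReal_exp, ← ofReal_log (Real.exp_pos u).le, Real.log_exp]
  simp only [abs_of_pos (Real.exp_pos u), real_smul, ofReal_exp, him, ofReal_neg, ← Complex.exp_add]
  congr 1; ring

theorem norm_cexp_mul_sub_mul_exp (s c : ℂ) (u : ℝ) :
    ‖exp (s * u - c * exp u)‖ = Real.exp (s.re * u - c.re * Real.exp u) := by
  rw [norm_exp, ← ofReal_exp]
  simp only [sub_re, re_mul_ofReal]

theorem integrable_cexp_mul_sub_mul_exp {s c : ℂ} (hs : 0 < s.re) (hc : 0 < c.re) :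
    Integrable (fun u : ℝ => exp (s * u - c * exp u)) := by
  refine (integrable_rexp_mul_sub_mul_exp hs hc).mono' (by fun_prop)
    (Eventually.of_forall fun u => (norm_cexp_mul_sub_mul_exp s c u).le)

/-- Rotation of the line of integration in Euler's integral. -/
theorem integral_cexp_rotated {s : ℂ} (hs : 0 < s.re) {y : ℝ} (hy : |y| < Real.pi / 2) :
    ∫ u : ℝ, exp (s * (u + y * I) - exp (u + y * I)) = Gamma s := by
  set F : ℝ → ℝ → ℂ := fun y u => exp (s * (u + y * I) - exp (u + y * I)) with hF
  set F' : ℝ → ℝ → ℂ := fun y u => F y u * (s * I - exp (u + y * I) * I) with hF'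
  set S : Set ℝ := Set.Ioo (-(Real.pi / 2)) (Real.pi / 2)
  have hnorm : ∀ y u : ℝ, ‖F y u‖ =
      Real.exp (-(s.im * y)) * Real.exp (s.re * u - Real.cos y * Real.exp u) := by
    intro y u
    rw [hF]; simp only [norm_exp, sub_re, mul_re, exp_re]
    simp [← Real.exp_add]
    ring
  have hcont : ∀ y, Continuous (F y) := fun y => by simp only [hF]; fun_prop
  have hcont' : ∀ y, Continuous (F' y) := fun y => by simp only [hF', hF]; fun_prop
  have hint : ∀ y ∈ S, Integrable (F y) := by
    intro y hy
    refine ((integrable_rexp_mul_sub_mul_exp hs (Real.cos_pos_of_mem_Ioo hy)).const_mul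
      (Real.exp (-(s.im * y)))).mono' (hcont y).aestronglyMeasurable
      (Eventually.of_forall fun u => (hnorm y u).le)
  have hderiv_u : ∀ y u : ℝ, HasDerivAt (F y) (F y u * (s - exp (u + y * I))) u := by
    intro y u
    have h1 : HasDerivAt (fun u : ℝ => (u : ℂ) + y * I) 1 u :=
      (ofRealCLM.hasDerivAt (x := u)).add_const _
    have h2 := ((h1.const_mul s).sub h1.cexp).cexp
    simpa [hF] using h2
  have hderiv_y : ∀ y u : ℝ, HasDerivAt (fun y => F y u) (F' y u) y := by
    intro y u
    have h1 : HasDerivAt (fun y : ℝ => (u : ℂ) + y * I) I y := by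
      simpa using ((ofRealCLM.hasDerivAt (x := y)).mul_const I).const_add (u : ℂ)
    have h2 := ((h1.const_mul s).sub h1.cexp).cexp
    simpa [hF, hF'] using h2
  -- The integral does not depend on `y`: `F' = i ∂F/∂u` is a total derivative in `u`, so its
  -- integral vanishes.
  have hzero : ∀ y ∈ S, HasDerivAt (fun y => ∫ u, F y u) 0 y := by
    intro y hy
    -- Keeping `|x| < δ < π/2` makes the decay rate `cos x ≥ cos δ > 0` uniform near `y`.
    obtain ⟨δ, hδ, hδy⟩ : ∃ δ, δ < Real.pi / 2 ∧ |y| < δ := by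
      obtain ⟨δ, h1, h2⟩ := exists_between (abs_lt.2 hy); exact ⟨δ, h2, h1⟩
    have hκ : 0 < Real.cos δ :=
      Real.cos_pos_of_mem_Ioo ⟨by linarith [abs_nonneg y, Real.pi_pos], hδ⟩
    have hs1 : 0 < s.re + 1 := by linarith
    have hbd : ∀ x ∈ Set.Ioo (-δ) δ, ∀ u, ‖F' x u‖ ≤ Real.exp (|s.im| * δ) *
        (‖s‖ * Real.exp (s.re * u - Real.cos δ * Real.exp u) +
          Real.exp ((s.re + 1) * u - Real.cos δ * Real.exp u)) := by
      intro x hx u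
      have hxa : |x| ≤ δ := (abs_lt.2 hx).le
      have hcos : Real.cos δ ≤ Real.cos x := by
        rw [← Real.cos_abs x]
        exact Real.cos_le_cos_of_nonneg_of_le_pi (abs_nonneg x) (by linarith [Real.pi_pos]) hxa
      have h1 : ‖F x u‖ ≤ Real.exp (|s.im| * δ) *
          Real.exp (s.re * u - Real.cos δ * Real.exp u) := by
        rw [hnorm]
        gcongr
        calc -(s.im * x) ≤ |s.im * x| := neg_le_abs _
          _ = |s.im| * |x| := abs_mul _ _
          _ ≤ |s.im| * δ := by gcongr
      have h2 : ‖s * I - exp (u + x * I) * I‖ ≤ ‖s‖ + Real.exp u := by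
        refine (norm_sub_le _ _).trans ?_
        simp [norm_exp]
      calc ‖F' x u‖ = ‖F x u‖ * ‖s * I - exp (u + x * I) * I‖ := norm_mul _ _
        _ ≤ (Real.exp (|s.im| * δ) * Real.exp (s.re * u - Real.cos δ * Real.exp u)) *
            (‖s‖ + Real.exp u) := by gcongr
        _ = _ := by
          rw [show (s.re + 1) * u - Real.cos δ * Real.exp u =
            (s.re * u - Real.cos δ * Real.exp u) + u by ring, Real.exp_add _ u]
          ring
    have hmain := hasDerivAt_integral_of_dominated_loc_of_deriv_le (μ := volume) (F := F) (F' := F')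
      (x₀ := y) (s := Set.Ioo (-δ) δ) (Ioo_mem_nhds (abs_lt.1 hδy).1 (abs_lt.1 hδy).2)
      (Eventually.of_forall fun x => (hcont x).aestronglyMeasurable) (hint y hy)
      (hcont' y).aestronglyMeasurable
      (Eventually.of_forall fun u x hx => hbd x hx u)
      ((((integrable_rexp_mul_sub_mul_exp hs hκ).const_mul _).add
        (integrable_rexp_mul_sub_mul_exp hs1 hκ)).const_mul _)
      (Eventually.of_forall fun u x _ => hderiv_y x u)
    have hval : ∫ u, F' y u = 0 := by
      have hi : Integrable (fun u => F y u * (s - exp (u + y * I))) := by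
        refine (hmain.1.mul_const (-I)).congr (Eventually.of_forall fun u => ?_)
        simp only [hF']
        linear_combination (-F y u * (s - exp (u + y * I))) * I_mul_I
      have h0 := integral_eq_zero_of_hasDerivAt_of_integrable (hderiv_u y) hi (hint y hy)
      calc ∫ u, F' y u = ∫ u, F y u * (s - exp (u + y * I)) * I := by
            congr 1; ext u; simp only [hF']; ring
        _ = 0 := by rw [integral_mul_const, h0, zero_mul]
    rw [← hval]; exact hmain.2
  have hyS : y ∈ S := abs_lt.1 hy
  have h0S : (0 : ℝ) ∈ S := ⟨by linarith [Real.pi_pos], by linarith [Real.pi_pos]⟩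
  have hle := Convex.norm_image_sub_le_of_norm_hasDerivWithin_le (C := 0)
    (fun x hx => (hzero x hx).hasDerivWithinAt) (by simp) (convex_Ioo _ _) h0S hyS
  have heq : ∫ u, F y u = ∫ u, F 0 u := by
    rw [zero_mul] at hle
    exact sub_eq_zero.1 (norm_le_zero_iff.1 hle)
  rw [heq]
  simpa [hF] using integral_cexp_mul_sub_exp hs

/-- Since `c e^u = e^{u + log c}`, the modulus of `c` is absorbed by a translation and its argument
by the rotation. -/
theorem integral_cexp_mul_sub_mul_exp {s c : ℂ} (hs : 0 < s.re) (hc : 0 < c.re) :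
    ∫ u : ℝ, exp (s * u - c * exp u) = c ^ (-s) * Gamma s := by
  have hc0 : c ≠ 0 := by rintro rfl; simp at hc
  have harg : |(Complex.log c).im| < Real.pi / 2 := by
    rw [log_im]; exact abs_arg_lt_pi_div_two_iff.2 (Or.inl hc)
  rw [← integral_cexp_rotated hs harg, ← integral_add_right_eq_self
    (fun u : ℝ => exp (s * (u + (Complex.log c).im * I) - exp (u + (Complex.log c).im * I)))
    (Real.log ‖c‖), ← integral_const_mul]
  congr 1; ext u
  have hlog : (u : ℂ) + Complex.log c = ((u + Real.log ‖c‖ : ℝ) : ℂ) + (Complex.log c).im * I := by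
    apply Complex.ext <;> simp [log_re]
  rw [← hlog, exp_add, exp_log hc0, cpow_def_of_ne_zero hc0, ← exp_add]
  congr 1; ring

/-! ### The logistic kernel: integral, symmetry, tail. -/

/-- The kernel `exp (s w) / (1 + exp w)` on the horizontal line `w = x + i θ`. -/
noncomputable def logisticKernel (s : ℂ) (θ x : ℝ) : ℂ :=
  exp (s * (x + θ * I)) / (1 + exp (x + θ * I))

theorem one_add_cexp_ne_zero {θ : ℝ} (hθ : |θ| < Real.pi) (x : ℝ) :
    1 + exp ((x : ℂ) + θ * I) ≠ 0 := by
  intro h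
  have hc : 0 < Real.cos (θ / 2) := by
    apply Real.cos_pos_of_mem_Ioo
    constructor <;> linarith [(abs_lt.1 hθ).1, (abs_lt.1 hθ).2]
  -- Multiplied by `e^{-iθ/2}`, the denominator has real part `(1 + e^x) cos(θ/2) > 0`.
  have h2 : exp (-(θ / 2 : ℝ) * I) + exp (x + (θ / 2 : ℝ) * I) = 0 := by
    calc _ = exp (-(θ / 2 : ℝ) * I) * (1 + exp ((x : ℂ) + θ * I)) := by
          rw [mul_add, mul_one, ← exp_add]; congr 2; push_cast; ring
      _ = 0 := by rw [h, mul_zero]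
  have h3 := congrArg re h2
  simp only [← ofReal_neg, add_re, exp_re, zero_re, re_ofReal_mul, im_ofReal_mul, I_re, I_im,
    ofReal_re, ofReal_im, add_im, mul_zero, mul_one, add_zero, zero_add, Real.exp_zero,
    Real.cos_neg, one_mul] at h3
  nlinarith [Real.exp_pos x]

theorem continuous_logisticKernel (s : ℂ) {θ : ℝ} (hθ : |θ| < Real.pi) :
    Continuous (logisticKernel s θ) := by
  unfold logisticKernel
  exact Continuous.div (by fun_prop) (by fun_prop) (one_add_cexp_ne_zero hθ)

/-- Up to a constant factor the kernel is a convolution of two Euler integrands, so its integral is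
a product `Γ(s)Γ(1-s)`, evaluated by the reflection formula. Splitting `θ` into halves between `c`
and `d` gives both the positive real part `cos(θ/2)`. -/
theorem logisticKernel_integrable_and_integral {s : ℂ} (hs0 : 0 < s.re) (hs1 : s.re < 1) {θ : ℝ}
    (hθ : |θ| < Real.pi) :
    Integrable (logisticKernel s θ) ∧
      ∫ x, logisticKernel s θ x = Real.pi / sin (Real.pi * s) := by
  have hcos : 0 < Real.cos (θ / 2) := by
    apply Real.cos_pos_of_mem_Ioo
    constructor <;> linarith [(abs_lt.1 hθ).1, (abs_lt.1 hθ).2]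
  have harg : -Real.pi < θ / 2 ∧ θ / 2 < Real.pi ∧ -Real.pi < -(θ / 2) := by
    refine ⟨?_, ?_, ?_⟩ <;> linarith [(abs_lt.1 hθ).1, (abs_lt.1 hθ).2, Real.pi_pos]
  set c : ℂ := exp ((θ / 2 : ℝ) * I) with hc
  set d : ℂ := exp ((-(θ / 2) : ℝ) * I) with hd
  have hcre : c.re = Real.cos (θ / 2) := exp_ofReal_mul_I_re _
  have hdre : d.re = Real.cos (θ / 2) := by rw [hd, exp_ofReal_mul_I_re, Real.cos_neg]
  have hs1' : 0 < (1 - s).re := by simpa using hs1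
  have hlogc : Complex.log c = (θ / 2 : ℝ) * I := by
    rw [hc, log_exp] <;> simp <;> linarith
  have hlogd : Complex.log d = (-(θ / 2) : ℝ) * I := by
    rw [hd, log_exp] <;> simp <;> linarith
  set f : ℝ → ℂ := fun t => exp ((1 - s) * (-t : ℝ) - d * exp (-t : ℝ)) with hf
  set g : ℝ → ℂ := fun u => exp (s * u - c * exp u) with hg
  have hfi : Integrable f :=
    (integrable_cexp_mul_sub_mul_exp hs1' (by rw [hdre]; exact hcos)).comp_neg
  have hgi : Integrable g := integrable_cexp_mul_sub_mul_exp hs0 (by rw [hcre]; exact hcos)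
  have hconv : ∀ x, convolution f g (ContinuousLinearMap.mul ℝ ℂ) volume x =
      exp (θ / 2 * I - s * θ * I) * logisticKernel s θ x := by
    intro x
    have hre : 0 < (d + c * exp x).re := by
      rw [add_re, ← ofReal_exp, re_mul_ofReal, hdre, hcre]
      have := Real.exp_pos x
      positivity
    have hne : d + c * exp x ≠ 0 := fun h => by rw [h] at hre; simp at hre
    rw [convolution_def, ← integral_neg_eq_self]
    have h1 : ∀ t : ℝ, (ContinuousLinearMap.mul ℝ ℂ) (f (-t)) (g (x - -t)) =
        exp (s * x) * exp (1 * t - (d + c * exp x) * exp t) := by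
      intro t
      simp only [ContinuousLinearMap.mul_apply', hf, hg, ← exp_add, neg_neg, sub_neg_eq_add]
      clear_value c d
      congr 1
      push_cast
      linear_combination (-c) * exp_add (x : ℂ) t
    simp only [h1]
    rw [integral_const_mul, integral_cexp_mul_sub_mul_exp (by simp) hre, Gamma_one, mul_one,
      cpow_neg_one, ← div_eq_mul_inv, logisticKernel, mul_div_assoc',
      div_eq_div_iff hne (one_add_cexp_ne_zero hθ x), ← exp_add]
    rw [hc, hd, mul_add, mul_add, mul_one, ← exp_add, ← exp_add, ← exp_add, ← exp_add]
    congr 2 <;> push_cast <;> ring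
  have hker : logisticKernel s θ = fun x => exp (-(θ / 2 * I - s * θ * I)) *
      convolution f g (ContinuousLinearMap.mul ℝ ℂ) volume x := by
    ext x
    rw [hconv, ← mul_assoc, ← exp_add, neg_add_cancel, exp_zero, one_mul]
  refine ⟨?_, ?_⟩
  · rw [hker]
    exact (hfi.integrable_convolution _ hgi).const_mul _
  · have hfI : ∫ t, f t = d ^ (-(1 - s)) * Gamma (1 - s) := by
      rw [← integral_cexp_mul_sub_mul_exp hs1' (by rw [hdre]; exact hcos),
        ← integral_neg_eq_self]
      simp [hf]
    have hgI : ∫ t, g t = c ^ (-s) * Gamma s :=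
      integral_cexp_mul_sub_mul_exp hs0 (by rw [hcre]; exact hcos)
    rw [hker, integral_const_mul, integral_convolution _ hfi hgi, ContinuousLinearMap.mul_apply',
      hfI, hgI, ← Gamma_mul_Gamma_one_sub, cpow_def_of_ne_zero (exp_ne_zero _),
      cpow_def_of_ne_zero (exp_ne_zero _), hlogc, hlogd]
    have : exp (-(θ / 2 * I - s * θ * I)) * (exp ((-(θ / 2) : ℝ) * I * -(1 - s)) *
        exp ((θ / 2 : ℝ) * I * -s)) = 1 := by
      rw [← exp_add, ← exp_add]
      convert exp_zero using 2
      push_cast; ring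
    linear_combination Gamma s * Gamma (1 - s) * this

theorem integrable_logisticKernel {s : ℂ} (hs0 : 0 < s.re) (hs1 : s.re < 1) {θ : ℝ}
    (hθ : |θ| < Real.pi) : Integrable (logisticKernel s θ) :=
  (logisticKernel_integrable_and_integral hs0 hs1 hθ).1

theorem integral_logisticKernel {s : ℂ} (hs0 : 0 < s.re) (hs1 : s.re < 1) {θ : ℝ}
    (hθ : |θ| < Real.pi) : ∫ x, logisticKernel s θ x = Real.pi / sin (Real.pi * s) :=
  (logisticKernel_integrable_and_integral hs0 hs1 hθ).2

theorem integral_cexp_mul_logisticKernel {α θ : ℝ} (hα0 : 0 < α) (hα1 : α < 1)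
    (hθ : |θ| < Real.pi) (τ : ℝ) :
    ∫ x : ℝ, exp (I * τ * x) * logisticKernel α θ x =
      exp (θ * τ) * (Real.pi / sin (Real.pi * (α + I * τ))) := by
  rw [← integral_logisticKernel (s := α + I * τ) (by simpa using hα0) (by simpa using hα1) hθ,
    ← integral_const_mul]
  congr 1; ext x
  rw [logisticKernel, logisticKernel, mul_div_assoc', mul_div_assoc', ← exp_add, ← exp_add]
  congr 2
  linear_combination (-(θ * τ) : ℂ) * I_mul_I

/-- This symmetry swaps the two tails of the kernel, so only one of them needs analysis. -/
theorem logisticKernel_one_sub_neg (α : ℂ) {θ : ℝ} (hθ : |θ| < Real.pi) (x : ℝ) :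
    logisticKernel (1 - α) (-θ) (-x) = logisticKernel α θ x := by
  rw [logisticKernel, logisticKernel, div_eq_div_iff (one_add_cexp_ne_zero (by rwa [abs_neg]) _)
    (one_add_cexp_ne_zero hθ _)]
  simp only [mul_add, mul_one, ← exp_add]
  rw [add_comm]
  congr 2 <;> push_cast <;> ring

theorem logisticKernel_eq_sub (α : ℂ) {θ : ℝ} (hθ : |θ| < Real.pi) (x : ℝ) :
    logisticKernel α θ x =
      exp (α * (x + θ * I)) - exp (x + θ * I) * logisticKernel α θ x := by
  have := one_add_cexp_ne_zero hθ x
  rw [logisticKernel]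
  field_simp
  ring

/-! ### The Fourier multiplier and inversion. -/

theorem sin_mul_cosh_le_norm_sin {x : ℝ} (hx : 0 ≤ Real.sin x) (y : ℝ) :
    Real.sin x * Real.cosh y ≤ ‖sin (x + y * I)‖ := by
  rw [← sq_le_sq₀ (by positivity) (norm_nonneg _), Complex.sq_norm, sin_add_mul_I, normSq_apply]
  simp only [← ofReal_sin, ← ofReal_cos, ← ofReal_cosh, ← ofReal_sinh]
  simp only [add_re, add_im, ofReal_re, ofReal_im, mul_re, mul_im,
    I_re, I_im]
  nlinarith [sq_nonneg (Real.cos x * Real.sinh y)]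

/-- The Fourier multiplier of the logistic kernel is integrable. -/
theorem integrable_exp_div_sin {α θ : ℝ} (hα0 : 0 < α) (hα1 : α < 1) (hθ : |θ| < Real.pi) :
    Integrable (fun τ : ℝ => exp (θ * τ) * (Real.pi / sin (Real.pi * (α + I * τ)))) := by
  have hsin : 0 < Real.sin (Real.pi * α) :=
    Real.sin_pos_of_pos_of_lt_pi (by positivity) (by nlinarith [Real.pi_pos])
  have hpi := Real.pi_pos
  -- With this `s`, the kernel at angle `0` and point `2πτ` equals `e^{θτ} / (2 cosh πτ)`, the
  -- required majorant up to a constant; `|θ| < π` is exactly `0 < s < 1`.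
  set s : ℝ := (θ + Real.pi) / (2 * Real.pi) with hs
  have hs0 : 0 < s := by
    have : 0 < θ + Real.pi := by linarith [(abs_lt.1 hθ).1]
    positivity
  have hs1 : s < 1 := by
    rw [hs, div_lt_one (by positivity)]; linarith [(abs_lt.1 hθ).2]
  have hb := ((integrable_logisticKernel (s := (s : ℂ)) (θ := 0) (by simpa using hs0)
    (by simpa using hs1) (by simpa using hpi)).comp_mul_left'
      (R := 2 * Real.pi) (by positivity)).norm.const_mul (2 * Real.pi / Real.sin (Real.pi * α))
  have harg : ∀ τ : ℝ, (Real.pi : ℂ) * (α + I * τ) =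
      ((Real.pi * α : ℝ) : ℂ) + ((Real.pi * τ : ℝ) : ℂ) * I := by
    intro τ; push_cast; ring
  have hlow : ∀ τ : ℝ, Real.sin (Real.pi * α) * Real.cosh (Real.pi * τ) ≤
      ‖sin (Real.pi * (α + I * τ))‖ := by
    intro τ
    rw [harg]; exact sin_mul_cosh_le_norm_sin hsin.le _
  have hpos : ∀ τ : ℝ, 0 < Real.sin (Real.pi * α) * Real.cosh (Real.pi * τ) := fun τ =>
    mul_pos hsin (Real.cosh_pos _)
  refine hb.mono' (Continuous.aestronglyMeasurable ?_) (Eventually.of_forall fun τ => ?_)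
  · refine Continuous.mul (by fun_prop) (Continuous.div (by fun_prop) (by fun_prop) fun τ h => ?_)
    have := hlow τ
    rw [h, norm_zero] at this
    linarith [hpos τ]
  · have hk : ‖logisticKernel s 0 (2 * Real.pi * τ)‖ =
        Real.exp ((θ + Real.pi) * τ) / (1 + Real.exp (2 * Real.pi * τ)) := by
      have e1 : logisticKernel s 0 (2 * Real.pi * τ) =
          ((Real.exp ((θ + Real.pi) * τ) / (1 + Real.exp (2 * Real.pi * τ)) : ℝ) : ℂ) := by
        rw [logisticKernel]
        push_cast
        simp only [zero_mul, add_zero]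
        congr 2
        rw [hs]; push_cast
        field_simp
      rw [e1, norm_real, Real.norm_of_nonneg (by positivity)]
    have hcosh : Real.exp ((θ + Real.pi) * τ) / (1 + Real.exp (2 * Real.pi * τ)) =
        Real.exp (θ * τ) / (2 * Real.cosh (Real.pi * τ)) := by
      rw [div_eq_div_iff (by positivity) (by have := Real.cosh_pos (Real.pi * τ); positivity),
        Real.cosh_eq, mul_div_cancel₀ _ two_ne_zero, mul_add, mul_add, mul_one, ← Real.exp_add,
        ← Real.exp_add, ← Real.exp_add, add_comm]
      congr 2 <;> ring
    rw [hk, hcosh, norm_mul, norm_div, norm_exp, norm_real, Real.norm_of_nonneg hpi.le,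
      ← ofReal_mul, ofReal_re]
    calc Real.exp (θ * τ) * (Real.pi / ‖sin (Real.pi * (α + I * τ))‖)
        ≤ Real.exp (θ * τ) * (Real.pi / (Real.sin (Real.pi * α) * Real.cosh (Real.pi * τ))) := by
          gcongr
          exact hlow τ
      _ = _ := by
          have := Real.cosh_pos (Real.pi * τ)
          field_simp

/-- Fourier inversion for the kernel. -/
theorem integral_cexp_mul_exp_div_sin {α θ : ℝ} (hα0 : 0 < α) (hα1 : α < 1)
    (hθ : |θ| < Real.pi) (y : ℝ) :
    ∫ τ : ℝ, exp (I * τ * y) * (exp (θ * τ) * (Real.pi / sin (Real.pi * (α + I * τ)))) =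
      2 * Real.pi * logisticKernel α θ (-y) := by
  set M : ℝ → ℂ := fun τ => exp (θ * τ) * (Real.pi / sin (Real.pi * (α + I * τ))) with hM
  have hMi : Integrable M := integrable_exp_div_sin hα0 hα1 hθ
  have hpi := Real.pi_pos
  -- The convention `e^{-2πixξ}` corresponds to `τ = -2πξ`.
  have hF : FourierTransform.fourier (logisticKernel (α : ℂ) θ) =
      fun ξ : ℝ => M (-(2 * Real.pi) * ξ) := by
    ext ξ
    rw [Real.fourier_eq', hM]
    beta_reduce
    rw [← integral_cexp_mul_logisticKernel hα0 hα1 hθ]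
    congr 1; ext x
    rw [smul_eq_mul]
    congr 2
    simp only [RCLike.inner_apply, conj_trivial]
    push_cast; ring
  have hinv := (continuous_logisticKernel (α : ℂ) hθ).fourierInv_fourier_eq
    (integrable_logisticKernel (by simpa using hα0) (by simpa using hα1) hθ)
    (by rw [hF]; exact hMi.comp_mul_left' (by linarith))
  have hv := congrFun hinv (-y)
  rw [← hv, Real.fourierInv_eq', hF]
  have hcv := Measure.integral_comp_mul_left (fun τ : ℝ => exp (I * τ * y) * M τ) (-(2 * Real.pi))
  have habs : |(-(2 * Real.pi))⁻¹| = (2 * Real.pi)⁻¹ := by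
    rw [inv_neg, abs_neg, abs_of_pos (by positivity)]
  rw [habs, real_smul] at hcv
  have h2 : ∫ v : ℝ, exp (((2 * Real.pi * inner ℝ v (-y) : ℝ) : ℂ) * I) •
      M (-(2 * Real.pi) * v) = ∫ x : ℝ, exp (I * ((-(2 * Real.pi) * x : ℝ) : ℂ) * y) *
        M (-(2 * Real.pi) * x) := by
    congr 1; ext x
    rw [smul_eq_mul]
    congr 2
    simp only [RCLike.inner_apply, conj_trivial]
    push_cast; ring
  have hne : (2 * Real.pi : ℂ) ≠ 0 := mul_ne_zero two_ne_zero (ofReal_ne_zero.2 hpi.ne')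
  rw [h2, hcv, ofReal_inv, ofReal_mul, ofReal_ofNat, ← mul_assoc, mul_inv_cancel₀ hne, one_mul]

/-! ### Smoothing `exp (-a cosh)` for small `a`. -/

theorem norm_cexp_neg_sub_one_le {x : ℂ} (hx : 0 ≤ x.re) : ‖exp (-x) - 1‖ ≤ ‖x‖ := by
  have h := Convex.norm_image_sub_le_of_norm_hasDerivWithin_le (f := fun z : ℂ => exp (-z))
    (f' := fun z => exp (-z) * -1) (s := {z : ℂ | 0 ≤ z.re}) (x := 0) (y := x) (C := 1)
    (fun z _ => ((hasDerivAt_id z).neg.cexp).hasDerivWithinAt)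
    (fun z hz => by
      have : 0 ≤ z.re := hz
      simpa [norm_exp] using this) (convex_halfSpace_re_ge 0) (by simp) hx
  simpa using h

theorem norm_mul_cexp (c : ℂ) (s : ℝ) : ‖c * exp s‖ = ‖c‖ * Real.exp s := by
  simp [norm_exp]

theorem re_mul_cexp_nonneg {c : ℂ} (hc : 0 < c.re) (s : ℝ) : 0 ≤ (c * exp s).re := by
  rw [← ofReal_exp, re_mul_ofReal]
  positivity

theorem norm_cexp_neg_mul_exp_sub_one_le {c : ℂ} (hc : 0 < c.re) (s : ℝ) :
    ‖exp (-(c * exp s)) - 1‖ ≤ ‖c‖ * Real.exp s :=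
  (norm_cexp_neg_sub_one_le (re_mul_cexp_nonneg hc s)).trans_eq (norm_mul_cexp c s)

theorem norm_cexp_neg_mul_exp_sub_one_le_two {c : ℂ} (hc : 0 < c.re) (s : ℝ) :
    ‖exp (-(c * exp s)) - 1‖ ≤ 2 := by
  refine (norm_sub_le _ _).trans ?_
  have : ‖exp (-(c * exp s))‖ ≤ 1 := by
    rw [norm_exp, Real.exp_le_one_iff, neg_re, neg_nonpos]
    exact re_mul_cexp_nonneg hc s
  rw [norm_one]; linarith

/-- The regularised Gamma integral at `-α`, `0 < α < 1`. -/
theorem integrable_and_integral_exp_sub_one {α : ℝ} (hα0 : 0 < α) (hα1 : α < 1) {c : ℂ}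
    (hc : 0 < c.re) :
    Integrable (fun s : ℝ => exp (-α * s) * (exp (-(c * exp s)) - 1)) ∧
      ∫ s : ℝ, exp (-α * s) * (exp (-(c * exp s)) - 1) =
        -(c ^ (α : ℂ) * (Gamma (1 - α) / α)) := by
  set f : ℝ → ℂ := fun s => exp (-α * s) * (exp (-(c * exp s)) - 1) with hf
  set g : ℝ → ℂ := fun s => c * exp ((1 - α) * s - c * exp s) with hg
  have hnorm : ∀ s : ℝ, ‖exp (-α * s : ℂ)‖ = Real.exp (-α * s) := by
    intro s; rw [norm_exp]; simp
  have hb1 : ∀ s : ℝ, ‖f s‖ ≤ ‖c‖ * Real.exp ((1 - α) * s) := by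
    intro s
    rw [hf]; simp only [norm_mul, hnorm]
    calc _ ≤ Real.exp (-α * s) * (‖c‖ * Real.exp s) := by
          gcongr; exact norm_cexp_neg_mul_exp_sub_one_le hc s
      _ = _ := by
          rw [show (1 - α) * s = -α * s + s by ring, Real.exp_add]; ring
  have hb2 : ∀ s : ℝ, ‖f s‖ ≤ 2 * Real.exp (-α * s) := by
    intro s
    rw [hf]; simp only [norm_mul, hnorm]
    rw [mul_comm]
    gcongr; exact norm_cexp_neg_mul_exp_sub_one_le_two hc s
  have hcont : Continuous f := by simp only [hf]; fun_prop
  have hfi : Integrable f := by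
    -- The linear bound controls `s → -∞` as `α < 1`; the bound by `2` controls `s → +∞` as `α > 0`.
    rw [← integrableOn_univ, ← Set.Iic_union_Ioi (a := (0 : ℝ)), integrableOn_union]
    constructor
    · exact Integrable.mono' ((integrableOn_exp_mul_Iic (by linarith : 0 < 1 - α) 0).const_mul ‖c‖)
        hcont.aestronglyMeasurable (Eventually.of_forall hb1)
    · exact Integrable.mono' ((integrableOn_exp_mul_Ioi (by linarith : -α < 0) 0).const_mul 2)
        hcont.aestronglyMeasurable (Eventually.of_forall hb2)
  have hs1 : 0 < (1 - α : ℂ).re := by simpa using hα1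
  have hgi : Integrable g := (integrable_cexp_mul_sub_mul_exp hs1 hc).const_mul c
  have hc0 : c ≠ 0 := by rintro rfl; simp at hc
  have hα : (α : ℂ) ≠ 0 := ofReal_ne_zero.2 hα0.ne'
  have hgI : ∫ s, g s = c ^ (α : ℂ) * Gamma (1 - α) := by
    rw [hg, integral_const_mul, integral_cexp_mul_sub_mul_exp hs1 hc, ← mul_assoc]
    congr 1
    rw [neg_sub, cpow_sub _ _ hc0, cpow_one]
    field_simp
  -- Integration by parts: `f' = -αf - g` has integral zero, so `α ∫ f = -∫ g`, and `∫ g` is a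
  -- convergent Gamma integral.
  have hder : ∀ s : ℝ, HasDerivAt f (-α * f s - g s) s := by
    intro s
    have h0 : HasDerivAt (fun s : ℝ => (s : ℂ)) 1 s := ofRealCLM.hasDerivAt
    have h1 := (h0.const_mul (-α : ℂ)).cexp
    have h2 := ((h0.cexp.const_mul c).neg.cexp).sub_const 1
    refine (h1.mul h2).congr_deriv ?_
    simp only [hf, hg, Pi.neg_apply]
    have e : exp ((1 - α) * s - c * exp s) = exp (-α * s) * exp s * exp (-(c * exp s)) := by
      rw [← exp_add, ← exp_add]; congr 1; ring
    rw [e]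
    ring
  have h0 := integral_eq_zero_of_hasDerivAt_of_integrable hder
    ((hfi.const_mul _).sub hgi) hfi
  rw [integral_sub (hfi.const_mul _) hgi, integral_const_mul, hgI] at h0
  refine ⟨hfi, ?_⟩
  field_simp
  linear_combination -h0

/-- Replacing the kernel by its tail `e^{α(x+iθ)}` leaves the regularised Gamma integral. The
remainder carries `e^{t-s}`, which cancels the growth in `|p(s)| ≤ |c| e^s` and leaves `|c| e^t`
times the kernel. -/
theorem logisticKernel_mul_exp_sub_one {α θ : ℝ} (hα0 : 0 < α) (hα1 : α < 1)
    (hθ : |θ| < Real.pi) {c : ℂ} (hc : 0 < c.re) (t : ℝ) :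
    Integrable (fun s : ℝ => logisticKernel α θ (t - s) * (exp (-(c * exp s)) - 1)) ∧
      ‖(∫ s : ℝ, logisticKernel α θ (t - s) * (exp (-(c * exp s)) - 1)) +
        c ^ (α : ℂ) * (Gamma (1 - α) / α) * exp (α * (t + θ * I))‖ ≤
        ‖c‖ * Real.exp t * ∫ x, ‖logisticKernel α θ x‖ := by
  obtain ⟨hi, hI⟩ := integrable_and_integral_exp_sub_one hα0 hα1 hc
  have hk : Integrable (logisticKernel α θ) :=
    integrable_logisticKernel (by simpa using hα0) (by simpa using hα1) hθ
  have hkc := continuous_logisticKernel (α : ℂ) hθ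
  set q : ℝ → ℂ := fun s => exp (((t - s : ℝ) : ℂ) + θ * I) * logisticKernel α θ (t - s) *
    (exp (-(c * exp s)) - 1) with hq
  have hqb : ∀ s, ‖q s‖ ≤ ‖c‖ * Real.exp t * ‖logisticKernel α θ (t - s)‖ := by
    intro s
    have h1 : ‖exp (((t - s : ℝ) : ℂ) + θ * I)‖ = Real.exp (t - s) := by
      rw [norm_exp]; simp
    simp only [hq, norm_mul, h1]
    calc _ ≤ Real.exp (t - s) * ‖logisticKernel α θ (t - s)‖ * (‖c‖ * Real.exp s) := by
          gcongr; exact norm_cexp_neg_mul_exp_sub_one_le hc s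
      _ = ‖c‖ * Real.exp (t - s + s) * ‖logisticKernel α θ (t - s)‖ := by
          rw [Real.exp_add]; ring
      _ = _ := by rw [sub_add_cancel]
  have hbi : Integrable (fun s => ‖c‖ * Real.exp t * ‖logisticKernel α θ (t - s)‖) :=
    (hk.comp_sub_left t).norm.const_mul _
  have hqi : Integrable q := by
    refine hbi.mono' (Continuous.aestronglyMeasurable ?_) (Eventually.of_forall hqb)
    have : Continuous fun s : ℝ => logisticKernel α θ (t - s) := hkc.comp (by fun_prop)
    simp only [hq]; fun_prop
  have hsplit : (fun s : ℝ => logisticKernel α θ (t - s) * (exp (-(c * exp s)) - 1)) =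
      fun s : ℝ => exp (α * (t + θ * I)) * (exp (-α * s) * (exp (-(c * exp s)) - 1)) - q s := by
    ext s
    have e := logisticKernel_eq_sub α hθ (t - s)
    have e2 : exp (α * (((t - s : ℝ) : ℂ) + θ * I)) = exp (α * (t + θ * I)) * exp (-α * s) := by
      rw [← exp_add]; congr 1; push_cast; ring
    rw [e2] at e
    simp only [hq]
    linear_combination (exp (-(c * exp s)) - 1) * e
  refine ⟨?_, ?_⟩
  · rw [hsplit]; exact (hi.const_mul _).sub hqi
  · rw [hsplit, integral_sub (hi.const_mul _) hqi, integral_const_mul, hI]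
    have : exp (α * (t + θ * I)) * -(c ^ (α : ℂ) * (Gamma (1 - α) / α)) - (∫ s, q s) +
        c ^ (α : ℂ) * (Gamma (1 - α) / α) * exp (α * (t + θ * I)) = -∫ s, q s := by ring
    rw [this, norm_neg]
    refine (norm_integral_le_of_norm_le hbi (Eventually.of_forall hqb)).trans_eq ?_
    rw [integral_const_mul, integral_sub_left_eq_self (fun x => ‖logisticKernel α θ x‖)]

theorem logisticKernel_mul_exp_neg_sub_one {α θ : ℝ} (hα0 : 0 < α) (hα1 : α < 1)
    (hθ : |θ| < Real.pi) {c : ℂ} (hc : 0 < c.re) (t : ℝ) :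
    Integrable (fun s : ℝ => logisticKernel α θ (t - s) * (exp (-(c * exp (-s : ℝ))) - 1)) ∧
      ‖(∫ s : ℝ, logisticKernel α θ (t - s) * (exp (-(c * exp (-s : ℝ))) - 1)) +
        c ^ (1 - α : ℂ) * (Gamma α / (1 - α)) * exp (-(1 - α) * (t + θ * I))‖ ≤
        ‖c‖ * Real.exp (-t) * ∫ x, ‖logisticKernel α θ x‖ := by
  have h := logisticKernel_mul_exp_sub_one (α := 1 - α) (θ := -θ) (by linarith) (by linarith)
    (by rwa [abs_neg]) hc (-t)
  simp only [ofReal_sub, ofReal_one, sub_sub_cancel] at h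
  have hneg : (fun s : ℝ => logisticKernel (1 - α) (-θ) (-t - s) * (exp (-(c * exp s)) - 1)) =
      fun s : ℝ => (fun s : ℝ => logisticKernel α θ (t - s) * (exp (-(c * exp (-s : ℝ))) - 1)) (-s)
      := by
    ext s
    beta_reduce
    rw [← logisticKernel_one_sub_neg _ hθ, neg_neg, sub_neg_eq_add, neg_add']
  have hn : ∫ x, ‖logisticKernel (1 - α) (-θ) x‖ = ∫ x, ‖logisticKernel α θ x‖ := by
    rw [← integral_neg_eq_self]
    simp only [logisticKernel_one_sub_neg _ hθ]
  rw [hneg, hn, integral_neg_eq_self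
    (fun s : ℝ => logisticKernel α θ (t - s) * (exp (-(c * exp (-s : ℝ))) - 1))] at h
  refine ⟨by simpa using h.1.comp_neg, ?_⟩
  convert h.2 using 5
  push_cast; ring

/-- Smoothing `exp (-a cosh)` by the logistic kernel, to first order in `a = 2 c`. -/
theorem norm_integral_logisticKernel_mul_exp_cosh_sub_le {α θ : ℝ} (hα0 : 0 < α) (hα1 : α < 1)
    (hθ : |θ| < Real.pi) {c : ℂ} (hc : 0 < c.re) (t : ℝ) :
    ‖(∫ s : ℝ, logisticKernel α θ (t - s) * exp (-(2 * c * cosh s))) -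
      (Real.pi / sin (Real.pi * α) -
        c ^ (α : ℂ) * (Gamma (1 - α) / α) * exp (α * (t + θ * I)) -
        c ^ (1 - α : ℂ) * (Gamma α / (1 - α)) * exp (-(1 - α) * (t + θ * I)))‖ ≤
      (‖c‖ * Real.exp t + ‖c‖ * Real.exp (-t) + ‖c‖ ^ 2) * ∫ x, ‖logisticKernel α θ x‖ := by
  obtain ⟨hpi, hpI⟩ := logisticKernel_mul_exp_sub_one hα0 hα1 hθ hc t
  obtain ⟨hqi, hqI⟩ := logisticKernel_mul_exp_neg_sub_one hα0 hα1 hθ hc t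
  have hk : Integrable (logisticKernel α θ) :=
    integrable_logisticKernel (by simpa using hα0) (by simpa using hα1) hθ
  have hkI := integral_logisticKernel (s := (α : ℂ)) (by simpa using hα0) (by simpa using hα1) hθ
  have hkc := continuous_logisticKernel (α : ℂ) hθ
  have hkt := hk.comp_sub_left t
  set K : ℝ → ℂ := fun s => logisticKernel α θ (t - s) with hK
  set p : ℝ → ℂ := fun s => exp (-(c * exp s)) - 1 with hp
  set q : ℝ → ℂ := fun s => exp (-(c * exp (-s : ℝ))) - 1 with hq
  -- The growth factors `e^s` and `e^{-s}` cancel, so the cross term is uniformly of second order.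
  have hrb : ∀ s, ‖K s * (p s * q s)‖ ≤ ‖c‖ ^ 2 * ‖K s‖ := by
    intro s
    have h1 : ‖p s‖ ≤ ‖c‖ * Real.exp s := norm_cexp_neg_mul_exp_sub_one_le hc s
    have h2 : ‖q s‖ ≤ ‖c‖ * Real.exp (-s) := norm_cexp_neg_mul_exp_sub_one_le hc (-s)
    rw [norm_mul, norm_mul]
    calc _ ≤ ‖K s‖ * ((‖c‖ * Real.exp s) * (‖c‖ * Real.exp (-s))) := by gcongr
      _ = ‖K s‖ * (‖c‖ ^ 2 * Real.exp (s + -s)) := by rw [Real.exp_add]; ring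
      _ = _ := by rw [add_neg_cancel, Real.exp_zero]; ring
  have hbi : Integrable (fun s => ‖c‖ ^ 2 * ‖K s‖) := hkt.norm.const_mul _
  have hri : Integrable (fun s => K s * (p s * q s)) := by
    refine hbi.mono' (Continuous.aestronglyMeasurable ?_) (Eventually.of_forall hrb)
    have : Continuous K := hkc.comp (by fun_prop)
    simp only [hp, hq]; fun_prop
  have hexp : (fun s : ℝ => K s * exp (-(2 * c * cosh s))) =
      fun s => K s + K s * p s + K s * q s + K s * (p s * q s) := by
    ext s
    have : exp (-(2 * c * cosh s)) = exp (-(c * exp s)) * exp (-(c * exp (-s : ℝ))) := by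
      rw [← exp_add, cosh]; congr 1; push_cast; ring
    rw [this]; simp only [hp, hq]; ring
  have hrI : ‖∫ s, K s * (p s * q s)‖ ≤ ‖c‖ ^ 2 * ∫ x, ‖logisticKernel α θ x‖ := by
    refine (norm_integral_le_of_norm_le hbi (Eventually.of_forall hrb)).trans_eq ?_
    rw [integral_const_mul, integral_sub_left_eq_self (fun x => ‖logisticKernel α θ x‖)]
  have hKI : ∫ s, K s = Real.pi / sin (Real.pi * α) := by
    rw [← hkI]; exact integral_sub_left_eq_self (logisticKernel α θ) volume t
  change ‖(∫ s : ℝ, K s * exp (-(2 * c * cosh s))) - _‖ ≤ _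
  have e1 : Integrable (fun s => K s + K s * p s) := hkt.add hpi
  have e2 : Integrable (fun s => K s + K s * p s + K s * q s) := e1.add hqi
  rw [hexp, integral_add e2 hri, integral_add e1 hqi, integral_add hkt hpi, hKI]
  calc _ = ‖((∫ s, K s * p s) + c ^ (α : ℂ) * (Gamma (1 - α) / α) * exp (α * (t + θ * I))) +
        ((∫ s, K s * q s) +
          c ^ (1 - α : ℂ) * (Gamma α / (1 - α)) * exp (-(1 - α) * (t + θ * I))) +
        ∫ s, K s * (p s * q s)‖ := by congr 1; ring
    _ ≤ _ := norm_add₃_le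
    _ ≤ _ := add_le_add (add_le_add hpI hqI) hrI
    _ = _ := by ring

/-! ### Macdonald functions and the integral over the order. -/

theorem norm_cexp_mul_sub_mul_cosh (μ a : ℂ) (s : ℝ) :
    ‖exp (μ * s - a * cosh s)‖ = Real.exp (μ.re * s - a.re * Real.cosh s) := by
  rw [norm_exp, ← ofReal_cosh, sub_re, re_mul_ofReal, re_mul_ofReal]

theorem integrable_cexp_mul_sub_mul_cosh (μ : ℂ) {a : ℂ} (ha : 0 < a.re) :
    Integrable (fun s : ℝ => exp (μ * s - a * cosh s)) := by
  -- The `+ 1` keeps `κ` positive when `Re μ = 0`; since `cosh s ≥ e^{|s|}/2`, one Euler integrand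
  -- dominates each half-line.
  set κ : ℝ := |μ.re| + 1 with hκ
  have hκ0 : 0 < κ := by positivity
  have h := integrable_rexp_mul_sub_mul_exp hκ0 (half_pos ha)
  refine (h.add h.comp_neg).mono' (by fun_prop) (Eventually.of_forall fun s => ?_)
  rw [norm_cexp_mul_sub_mul_cosh]
  simp only [Pi.add_apply]
  have hcosh := Real.cosh_eq s
  have hμ := abs_le.1 (le_refl |μ.re|)
  have e1 := Real.exp_pos s
  have e2 := Real.exp_pos (-s)
  rcases le_total 0 s with hs | hs
  · refine le_add_of_le_of_nonneg (Real.exp_le_exp.2 ?_) (Real.exp_pos _).le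
    rw [hcosh, hκ]
    nlinarith [mul_le_mul_of_nonneg_right hμ.2 hs, mul_pos ha e2]
  · refine le_add_of_nonneg_of_le (Real.exp_pos _).le (Real.exp_le_exp.2 ?_)
    rw [hcosh, hκ]
    nlinarith [mul_le_mul_of_nonpos_right hμ.1 hs, mul_pos ha e1]

theorem integral_cexp_mul_sub_mul_cosh (μ a : ℂ) :
    ∫ s : ℝ, exp (μ * s - a * cosh s) = 2 * besselK μ a := by
  rw [besselK, ← mul_assoc]; norm_num

/-- The integral over the order, as a double integral against the logistic kernel. -/
theorem integral_besselK_mul_besselK {α θ : ℝ} (hα0 : 0 < α) (hα1 : α < 1) (hθ : |θ| < Real.pi)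
    {a b : ℂ} (ha : 0 < a.re) (hb : 0 < b.re) (ν : ℂ) :
    Integrable (fun τ : ℝ => besselK (I * τ) a * besselK (I * (ν - τ)) b *
      (exp (θ * τ) * (Real.pi / sin (Real.pi * (α + I * τ))))) ∧
    Integrable (fun t : ℝ => exp (I * ν * t - b * cosh t) *
      ∫ s : ℝ, logisticKernel α θ (t - s) * exp (-(a * cosh s))) ∧
    ∫ τ : ℝ, besselK (I * τ) a * besselK (I * (ν - τ)) b *
      (exp (θ * τ) * (Real.pi / sin (Real.pi * (α + I * τ)))) =
    Real.pi / 2 * ∫ t : ℝ, exp (I * ν * t - b * cosh t) *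
      ∫ s : ℝ, logisticKernel α θ (t - s) * exp (-(a * cosh s)) := by
  set M : ℝ → ℂ := fun τ => exp (θ * τ) * (Real.pi / sin (Real.pi * (α + I * τ))) with hM
  have hMi : Integrable M := integrable_exp_div_sin hα0 hα1 hθ
  set φ : ℝ → ℂ := fun s => exp (-(a * cosh s)) with hφ
  set ψ : ℝ → ℂ := fun t => exp (I * ν * t - b * cosh t) with hψ
  have hφi : Integrable φ := by simpa [hφ] using integrable_cexp_mul_sub_mul_cosh 0 ha
  have hψi : Integrable ψ := integrable_cexp_mul_sub_mul_cosh (I * ν) hb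
  set T : ℝ → ℝ × ℝ → ℂ := fun τ p => exp (I * τ * (p.1 - p.2 : ℝ)) *
    (M τ * (φ p.1 * ψ p.2)) with hT
  -- The only factor coupling `τ` with `s` and `t` is unimodular; the rest is a product of
  -- integrable functions, so Fubini applies.
  have hTi : Integrable (Function.uncurry T) (volume.prod (volume.prod volume)) := by
    refine (hMi.mul_prod (hφi.mul_prod hψi)).bdd_mul (c := 1) (by fun_prop)
      (Eventually.of_forall fun x => le_of_eq ?_)
    rw [norm_exp]; simp
  have hτ : ∀ τ, ∫ p, T τ p ∂(volume.prod volume) =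
      4 * (besselK (I * τ) a * besselK (I * (ν - τ)) b * M τ) := by
    intro τ
    have : ∀ p : ℝ × ℝ, T τ p = M τ * (exp (I * τ * p.1 - a * cosh p.1) *
        exp (I * (ν - τ) * p.2 - b * cosh p.2)) := by
      intro p
      simp only [hT, hφ, hψ]
      rw [mul_left_comm, ← exp_add, ← exp_add, ← exp_add]
      congr 2; push_cast; ring
    simp only [this]
    rw [integral_const_mul, integral_prod_mul (fun s : ℝ => exp (I * τ * s - a * cosh s))
      (fun t : ℝ => exp (I * (ν - τ) * t - b * cosh t)), integral_cexp_mul_sub_mul_cosh,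
      integral_cexp_mul_sub_mul_cosh]
    ring
  have hp : ∀ p, ∫ τ, T τ p = 2 * Real.pi * (ψ p.2 * (logisticKernel α θ (p.2 - p.1) * φ p.1)) := by
    intro p
    simp only [hT, ← mul_assoc]
    rw [integral_mul_const, integral_mul_const]
    have := integral_cexp_mul_exp_div_sin hα0 hα1 hθ (p.1 - p.2)
    simp only [hM, ← mul_assoc] at this ⊢
    rw [this, neg_sub]
    ring
  have hpi2 : (2 * Real.pi : ℂ) ≠ 0 := mul_ne_zero two_ne_zero (ofReal_ne_zero.2 Real.pi_pos.ne')
  have hpint : Integrable (fun p : ℝ × ℝ => ψ p.2 * (logisticKernel α θ (p.2 - p.1) * φ p.1))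
      (volume.prod volume) := by
    have h := hTi.integral_prod_right
    simp only [Function.uncurry_apply_pair, hp] at h
    simpa [← mul_assoc, inv_mul_cancel₀ hpi2] using h.const_mul (2 * Real.pi : ℂ)⁻¹
  refine ⟨?_, ?_, ?_⟩
  · have h := hTi.integral_prod_left
    simp only [Function.uncurry_apply_pair, hτ] at h
    exact (h.const_mul (4⁻¹ : ℂ)).congr
      (Eventually.of_forall fun τ => inv_mul_cancel_left₀ (by norm_num : (4 : ℂ) ≠ 0) _)
  · have h := hpint.integral_prod_right
    simpa only [integral_const_mul] using h
  · have h := integral_integral_swap hTi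
    simp only [hτ, hp] at h
    rw [integral_const_mul, integral_const_mul, integral_prod_symm _ hpint] at h
    simp only [integral_const_mul] at h
    linear_combination h / 4

/-! ### The expansion as `r` tends to zero. -/

/-- The principal root halves the argument, and `arg (-z) = π` would put `z` on the positive axis.
-/
theorem sqrt_neg_re_pos {z : ℂ} (hz : ∀ x : ℝ, 0 ≤ x → z ≠ (x : ℂ)) : 0 < (Complex.sqrt (-z)).re := by
  have h0 : -z ≠ 0 := fun h => hz 0 le_rfl (by simpa using h)
  have harg : arg (-z) ≠ Real.pi := by
    intro h
    rw [arg_eq_pi_iff] at h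
    refine hz z.re (by have := h.1; simp at this; linarith) (Complex.ext rfl ?_)
    simpa using h.2
  have h1 := neg_pi_lt_arg (-z)
  have h2 := lt_of_le_of_ne (arg_le_pi (-z)) harg
  rw [Complex.sqrt, cpow_def_of_ne_zero h0, exp_re]
  refine mul_pos (Real.exp_pos _) (Real.cos_pos_of_mem_Ioo ?_)
  have : (Complex.log (-z) * 2⁻¹).im = arg (-z) / 2 := by
    rw [show (2⁻¹ : ℂ) = ((2⁻¹ : ℝ) : ℂ) by push_cast; rfl, im_mul_ofReal, log_im]; ring
  rw [this]
  constructor <;> linarith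

/-- The small argument expansion, with an explicit error bound. -/
theorem exists_norm_integral_besselK_mul_besselK_sub_le {α θ : ℝ} (hα0 : 0 < α) (hα1 : α < 1)
    (hθ : |θ| < Real.pi) {b : ℂ} (hb : 0 < b.re) (ν : ℂ) :
    ∃ C : ℝ, ∀ c : ℂ, 0 < c.re →
      ‖(∫ τ : ℝ, besselK (I * τ) (2 * c) * besselK (I * (ν - τ)) b *
          (exp (θ * τ) * (Real.pi / sin (Real.pi * (α + I * τ))))) -
        (Real.pi * (Real.pi / sin (Real.pi * α)) * besselK (I * ν) b -
          Real.pi * (Gamma α / (1 - α)) * c ^ (1 - α : ℂ) * exp (I * (α - 1) * θ) *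
            besselK (I * ν - 1 + α) b -
          Real.pi * (Gamma (1 - α) / α) * c ^ (α : ℂ) * exp (I * α * θ) *
            besselK (I * ν + α) b)‖ ≤ C * (‖c‖ + ‖c‖ ^ 2) := by
  set ψ : ℂ → ℝ → ℂ := fun μ t => exp (μ * t - b * cosh t) with hψ
  have hψi : ∀ μ, Integrable (ψ μ) := fun μ => integrable_cexp_mul_sub_mul_cosh μ hb
  have hψe : ∀ (μ κ : ℂ) (t : ℝ), ψ μ t * exp (κ * t) = ψ (μ + κ) t := by
    intro μ κ t; simp only [hψ, ← exp_add]; congr 1; ring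
  have hψn : ∀ (μ : ℂ) (κ t : ℝ), ‖ψ μ t‖ * Real.exp (κ * t) = ‖ψ (μ + κ) t‖ := by
    intro μ κ t
    rw [← hψe, norm_mul, norm_exp (κ * t)]; simp
  set N := ∫ x, ‖logisticKernel α θ x‖ with hN
  have hN0 : 0 ≤ N := integral_nonneg fun _ => norm_nonneg _
  -- The three integrals absorb the weights `e^t`, `e^{-t}` and `1` of the pointwise smoothing
  -- error.
  refine ⟨Real.pi / 2 * (((∫ t, ‖ψ (I * ν + (1 : ℝ)) t‖) + (∫ t, ‖ψ (I * ν + (-1 : ℝ)) t‖) +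
    ∫ t, ‖ψ (I * ν) t‖) * N), fun c hc => ?_⟩
  have h2c : 0 < (2 * c).re := by simpa using hc
  obtain ⟨-, hGi, hF⟩ := integral_besselK_mul_besselK hα0 hα1 hθ h2c hb ν
  rw [hF]
  set G : ℝ → ℂ := fun t => ∫ s : ℝ, logisticKernel α θ (t - s) * exp (-(2 * c * cosh s)) with hG
  set A : ℂ := c ^ (α : ℂ) * (Gamma (1 - α) / α) with hA
  set B : ℂ := c ^ (1 - α : ℂ) * (Gamma α / (1 - α)) with hB
  set P : ℂ := Real.pi / sin (Real.pi * α) with hP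
  set L : ℝ → ℂ := fun t => P - A * exp (α * (t + θ * I)) - B * exp (-(1 - α) * (t + θ * I))
  have hL : (fun t => ψ (I * ν) t * L t) = fun t => P * ψ (I * ν) t -
      A * exp (I * α * θ) * ψ (I * ν + α) t - B * exp (I * (α - 1) * θ) * ψ (I * ν - 1 + α) t := by
    ext t
    have e1 : exp (α * (t + θ * I)) = exp (I * α * θ) * exp ((α : ℂ) * t) := by
      rw [← exp_add]; congr 1; ring
    have e2 : exp (-(1 - α) * (t + θ * I)) = exp (I * (α - 1) * θ) * exp ((-1 + α : ℂ) * t) := by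
      rw [← exp_add]; congr 1; ring
    have e3 : I * ν - 1 + α = I * ν + (-1 + α) := by ring
    rw [e3, ← hψe, ← hψe]
    simp only [L, e1, e2]
    ring
  have hi1 := (hψi (I * ν)).const_mul P
  have hi2 := (hψi (I * ν + α)).const_mul (A * exp (I * α * θ))
  have hi3 := (hψi (I * ν - 1 + α)).const_mul (B * exp (I * (α - 1) * θ))
  have hi12 : Integrable (fun t => P * ψ (I * ν) t - A * exp (I * α * θ) * ψ (I * ν + α) t) :=
    hi1.sub hi2
  have hLi : Integrable (fun t => ψ (I * ν) t * L t) := by rw [hL]; exact hi12.sub hi3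
  have hLI : ∫ t, ψ (I * ν) t * L t = P * (2 * besselK (I * ν) b) -
      A * exp (I * α * θ) * (2 * besselK (I * ν + α) b) -
      B * exp (I * (α - 1) * θ) * (2 * besselK (I * ν - 1 + α) b) := by
    rw [hL, integral_sub hi12 hi3, integral_sub hi1 hi2, integral_const_mul, integral_const_mul,
      integral_const_mul]
    simp only [hψ, integral_cexp_mul_sub_mul_cosh]
  have hrw : (Real.pi / 2 * ∫ t, ψ (I * ν) t * G t) -
        (Real.pi * P * besselK (I * ν) b -
          Real.pi * (Gamma α / (1 - α)) * c ^ (1 - α : ℂ) * exp (I * (α - 1) * θ) *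
            besselK (I * ν - 1 + α) b -
          Real.pi * (Gamma (1 - α) / α) * c ^ (α : ℂ) * exp (I * α * θ) *
            besselK (I * ν + α) b) =
      ((Real.pi / 2 : ℝ) : ℂ) * ∫ t, (ψ (I * ν) t * G t - ψ (I * ν) t * L t) := by
    rw [integral_sub hGi hLi, hLI, hA, hB]
    push_cast
    ring
  change ‖(Real.pi / 2 * ∫ t, ψ (I * ν) t * G t) - _‖ ≤ _
  rw [hrw, norm_mul, norm_real, Real.norm_of_nonneg (by positivity)]
  have hbd : ∀ t, ‖ψ (I * ν) t * G t - ψ (I * ν) t * L t‖ ≤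
      (‖c‖ * ‖ψ (I * ν + (1 : ℝ)) t‖ + ‖c‖ * ‖ψ (I * ν + (-1 : ℝ)) t‖ +
        ‖c‖ ^ 2 * ‖ψ (I * ν) t‖) * N := by
    intro t
    rw [← mul_sub, norm_mul, ← hψn, ← hψn, one_mul, neg_one_mul]
    calc _ ≤ ‖ψ (I * ν) t‖ * ((‖c‖ * Real.exp t + ‖c‖ * Real.exp (-t) + ‖c‖ ^ 2) * N) := by
          gcongr
          exact norm_integral_logisticKernel_mul_exp_cosh_sub_le hα0 hα1 hθ hc t
      _ = _ := by ring
  have hj1 := (hψi (I * ν + (1 : ℝ))).norm.const_mul ‖c‖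
  have hj2 := (hψi (I * ν + (-1 : ℝ))).norm.const_mul ‖c‖
  have hj3 := (hψi (I * ν)).norm.const_mul (‖c‖ ^ 2)
  have hj12 : Integrable (fun t => ‖c‖ * ‖ψ (I * ν + (1 : ℝ)) t‖ +
    ‖c‖ * ‖ψ (I * ν + (-1 : ℝ)) t‖) := hj1.add hj2
  have hle := norm_integral_le_of_norm_le ((hj12.add hj3).mul_const N) (Eventually.of_forall hbd)
  simp only [Pi.add_apply] at hle
  rw [integral_mul_const, integral_add hj12 hj3, integral_add hj1 hj2, integral_const_mul,
    integral_const_mul, integral_const_mul] at hle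
  rw [mul_assoc (Real.pi / 2)]
  refine mul_le_mul_of_nonneg_left (hle.trans ?_) (by positivity)
  have n1 : 0 ≤ ∫ t, ‖ψ (I * ν + (1 : ℝ)) t‖ := integral_nonneg fun _ => norm_nonneg _
  have n2 : 0 ≤ ∫ t, ‖ψ (I * ν + (-1 : ℝ)) t‖ := integral_nonneg fun _ => norm_nonneg _
  have n3 : 0 ≤ ∫ t, ‖ψ (I * ν) t‖ := integral_nonneg fun _ => norm_nonneg _
  rw [mul_right_comm]
  refine mul_le_mul_of_nonneg_right ?_ hN0
  nlinarith [norm_nonneg c, mul_nonneg n1 (sq_nonneg ‖c‖), mul_nonneg n2 (sq_nonneg ‖c‖),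
    mul_nonneg n3 (norm_nonneg c)]

theorem mainTheorem8 (z : ℂ) (hz : ∀ x : ℝ, 0 ≤ x → z ≠ (x : ℂ))
    (ρ : ℝ) (hρ : 0 < ρ) (ν : ℂ) (θ : ℝ) (hθ : |θ| < Real.pi)
    (α : ℝ) (hα0 : 0 < α) (hα1 : α < 1) :
    (∀ r : ℝ, 0 < r → Integrable (fun τ : ℝ =>
      besselK (I * τ) (Complex.sqrt (-z) * r) * besselK (I * (ν - τ)) (Complex.sqrt (-z) * ρ) *
        (sin (Real.pi * α) * exp (θ * τ) / (Real.pi * sin (Real.pi * (α + I * τ)))))) ∧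
    (fun r : ℝ =>
      (∫ τ : ℝ, besselK (I * τ) (Complex.sqrt (-z) * r) * besselK (I * (ν - τ)) (Complex.sqrt (-z) * ρ) *
        (sin (Real.pi * α) * exp (θ * τ) / (Real.pi * sin (Real.pi * (α + I * τ)))))
      - (besselK (I * ν) (Complex.sqrt (-z) * ρ)
        - sin (Real.pi * α) / Real.pi * (Gamma α / (1 - α)) *
            (Complex.sqrt (-z) * r / 2) ^ (1 - α : ℂ) * exp (I * (α - 1) * θ) *
            besselK (I * ν - 1 + α) (Complex.sqrt (-z) * ρ)
        - sin (Real.pi * α) / Real.pi * (Gamma (1 - α) / α) *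
            (Complex.sqrt (-z) * r / 2) ^ (α : ℂ) * exp (I * α * θ) *
            besselK (I * ν + α) (Complex.sqrt (-z) * ρ)))
      =O[𝓝[>] (0 : ℝ)] (fun r : ℝ => r) := by
  set w : ℂ := Complex.sqrt (-z)
  have hw : 0 < w.re := sqrt_neg_re_pos hz
  have hre : ∀ x : ℝ, 0 < x → 0 < (w * x).re := fun x hx => by
    rw [re_mul_ofReal]; exact mul_pos hw hx
  have hpi : (Real.pi : ℂ) ≠ 0 := ofReal_ne_zero.2 Real.pi_pos.ne'
  have hsin : sin (Real.pi * α) ≠ 0 := by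
    have : 0 < Real.sin (Real.pi * α) :=
      Real.sin_pos_of_pos_of_lt_pi (by positivity) (by nlinarith [Real.pi_pos])
    exact_mod_cast this.ne'
  have hM : ∀ τ : ℝ, sin (Real.pi * α) * exp (θ * τ) / (Real.pi * sin (Real.pi * (α + I * τ))) =
      sin (Real.pi * α) / Real.pi ^ 2 *
        (exp (θ * τ) * (Real.pi / sin (Real.pi * (α + I * τ)))) := by
    intro τ
    rw [div_mul_eq_mul_div, mul_div_assoc', mul_div_assoc', div_div, mul_comm _ (Real.pi ^ 2 : ℂ),
      pow_two, mul_assoc (Real.pi : ℂ), ← mul_assoc _ _ (Real.pi : ℂ), mul_comm _ (Real.pi : ℂ),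
      mul_div_mul_left _ _ hpi]
  have hint : ∀ r τ : ℝ, besselK (I * τ) (w * r) * besselK (I * (ν - τ)) (w * ρ) *
        (sin (Real.pi * α) * exp (θ * τ) / (Real.pi * sin (Real.pi * (α + I * τ)))) =
      sin (Real.pi * α) / Real.pi ^ 2 * (besselK (I * τ) (w * r) * besselK (I * (ν - τ)) (w * ρ) *
        (exp (θ * τ) * (Real.pi / sin (Real.pi * (α + I * τ))))) := by
    intro r τ; rw [hM]; ring
  simp only [hint, integral_const_mul]
  refine ⟨fun r hr => (integral_besselK_mul_besselK hα0 hα1 hθ (hre r hr) (hre ρ hρ) ν).1.const_mul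
    _, ?_⟩
  obtain ⟨C, hC⟩ := exists_norm_integral_besselK_mul_besselK_sub_le hα0 hα1 hθ (hre ρ hρ) ν
  -- For `r < 1` the quadratic error is absorbed by `r² ≤ r`.
  have hsmall : ∀ᶠ r : ℝ in 𝓝[>] (0 : ℝ), r ∈ Set.Ioo (0 : ℝ) 1 := Ioo_mem_nhdsGT one_pos
  have hO : (fun r : ℝ => ‖w * r / 2‖ + ‖w * r / 2‖ ^ 2) =O[𝓝[>] (0 : ℝ)] fun r : ℝ => r := by
    refine IsBigO.of_bound (‖w‖ / 2 + (‖w‖ / 2) ^ 2) (hsmall.mono fun r hr => ?_)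
    have h1 : ‖w * r / 2‖ = ‖w‖ / 2 * r := by
      rw [norm_div, norm_mul, norm_real, Real.norm_of_nonneg hr.1.le, norm_ofNat]; ring
    rw [h1, Real.norm_of_nonneg (by have := hr.1; positivity), Real.norm_of_nonneg hr.1.le, add_mul,
      mul_pow]
    gcongr
    nlinarith [hr.1, hr.2]
  refine IsBigO.trans (IsBigO.of_bound (‖sin (Real.pi * α) / (Real.pi : ℂ) ^ 2‖ * C)
    (hsmall.mono fun r hr => ?_)) hO
  have hc : 0 < (w * r / 2).re := by
    rw [show w * r / 2 = w * ((r / 2 : ℝ) : ℂ) by push_cast; ring]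
    exact hre _ (half_pos hr.1)
  have hmain := hC _ hc
  rw [mul_div_cancel₀ _ (two_ne_zero (α := ℂ))] at hmain
  rw [Real.norm_of_nonneg (by positivity)]
  refine le_trans (le_of_eq ?_) ((mul_le_mul_of_nonneg_left hmain
    (norm_nonneg (sin (Real.pi * α) / (Real.pi : ℂ) ^ 2))).trans_eq (mul_assoc _ _ _).symm)
  rw [← norm_mul]
  congr 1
  rw [mul_sub]
  have e1 : sin (Real.pi * α) / Real.pi ^ 2 * (Real.pi * (Real.pi / sin (Real.pi * α))) = 1 := by
    field_simp
  have e2 : sin (Real.pi * α) / Real.pi ^ 2 * (Real.pi : ℂ) = sin (Real.pi * α) / Real.pi := by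
    field_simp
  rw [← e2]
  linear_combination besselK (I * ν) (w * ρ) * e1
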